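/- Let $K$ be a field, let $n\ge 1$ and $t\ge 1$ be integers, let $R=K[x_1,\ldots,x_n]$, and let $M_{n,t}\subseteq R$ be the monomial ideal generated by the $n$ monomials $$x^{e_i}=\prod_{j\ne i}x_j^{t}=x_1^t\cdots x_{i-1}^t\,x_{i+1}^t\cdots x_n^t,\qquad i=1,\ldots,n.$$ Then the ring $R/M_{n,t}$ is Cohen–Macaulay (for $n=1$ one has $M_{1,t}=R$, and the zero ring counts as Cohen–Macaulay). Moreover, if $n\ge 3$ and $t\ge 2$, then the integral closure $$\overline{M_{n,t}}=\{\alpha\in R:\ \alpha^k+a_1\alpha^{k-1}+\cdots+a_k=0\ \text{for some } k\ge 1 \text{ and some } a_i\in M_{n,t}^{\,i}\}$$ has embedded primes, i.e. there is an associated prime of $R/\overline{M_{n,t}}$ that is not minimal among the primes containing $\overline{M_{n,t}}$. -/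

import Mathlib

open MvPolynomial

section IntegralClosure

variable {R : Type*} [CommRing R]

/-- `a` is integral over the ideal `I`: there is an equation
`a ^ k + c₁ a ^ (k - 1) + ⋯ + cₖ = 0` with `k ≥ 1` and `cᵢ ∈ I ^ i`. -/
def IsIntegralOverIdeal (I : Ideal R) (a : R) : Prop :=
  ∃ k : ℕ, 1 ≤ k ∧ ∃ c : ℕ → R, (∀ i ∈ Finset.Icc 1 k, c i ∈ I ^ i) ∧
    a ^ k + ∑ i ∈ Finset.Icc 1 k, c i * a ^ (k - i) = 0

theorem isIntegralOverIdeal_iff (I : Ideal R) (a : R) :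
    IsIntegralOverIdeal I a ↔ IsIntegral (reesAlgebra I) (Polynomial.monomial 1 a) := by
  constructor
  · rintro ⟨k, hk, c, hc, h⟩
    let d : ℕ → reesAlgebra I := fun i =>
      if hi : i ∈ Finset.Icc 1 k then
        ⟨Polynomial.monomial i (c i), reesAlgebra.monomial_mem.2 (hc i hi)⟩ else 0
    refine ⟨Polynomial.X ^ k + ∑ i ∈ Finset.Icc 1 k,
      Polynomial.C (d i) * Polynomial.X ^ (k - i), ?_, ?_⟩
    · apply Polynomial.monic_X_pow_add
      refine (Polynomial.degree_sum_le _ _).trans_lt ?_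
      rw [Finset.sup_lt_iff (WithBot.bot_lt_coe _)]
      intro i hi
      refine (Polynomial.degree_C_mul_X_pow_le _ _).trans_lt ?_
      rw [Finset.mem_Icc] at hi
      exact_mod_cast (by omega : k - i < k)
    · have hsum : ∑ i ∈ Finset.Icc 1 k,
          algebraMap (reesAlgebra I) (Polynomial R) (d i) *
            Polynomial.monomial 1 a ^ (k - i) =
          ∑ i ∈ Finset.Icc 1 k, Polynomial.monomial k (c i * a ^ (k - i)) := by
        refine Finset.sum_congr rfl fun i hi => ?_
        have h1 : algebraMap (reesAlgebra I) (Polynomial R) (d i) =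
            Polynomial.monomial i (c i) := by
          simp only [d, dif_pos hi]; rfl
        rw [Finset.mem_Icc] at hi
        rw [h1, Polynomial.monomial_pow, Polynomial.monomial_mul_monomial]
        have h2 : i + 1 * (k - i) = k := by omega
        rw [h2]
      simp only [Polynomial.eval₂_add, Polynomial.eval₂_finsetSum, Polynomial.eval₂_mul,
        Polynomial.eval₂_pow, Polynomial.eval₂_X, Polynomial.eval₂_C]
      rw [hsum, Polynomial.monomial_pow, one_mul, ← map_sum, ← map_add, h, map_zero]
  · rintro ⟨p, hp, h⟩
    have h' := congrArg (fun q => Polynomial.coeff q p.natDegree) h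
    simp only [Polynomial.eval₂_eq_sum_range, Polynomial.monomial_pow, one_mul,
      Polynomial.finsetSum_coeff, Polynomial.coeff_zero] at h'
    have hterm : ∀ i ∈ Finset.range (p.natDegree + 1),
        (algebraMap (reesAlgebra I) (Polynomial R) (p.coeff i) *
          Polynomial.monomial i (a ^ i)).coeff p.natDegree =
        (p.coeff i : Polynomial R).coeff (p.natDegree - i) * a ^ i := by
      intro i hi
      rw [Finset.mem_range] at hi
      have : p.natDegree = (p.natDegree - i) + i := by omega
      conv_lhs => rw [this]
      rw [Polynomial.coeff_mul_monomial]
      rfl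
    rw [Finset.sum_congr rfl hterm] at h'
    by_cases hk : p.natDegree = 0
    · have h1 : p.coeff 0 = 1 := by rw [← hk]; exact hp
      have h01 : (1 : R) = 0 := by simpa [hk, h1] using h'
      exact ⟨1, le_rfl, 0, fun i _ => (I ^ i).zero_mem, by
        rw [← mul_one (_ + _), h01, mul_zero]⟩
    refine ⟨p.natDegree, by omega, fun i => (p.coeff (p.natDegree - i) : Polynomial R).coeff i,
      fun i _ => (mem_reesAlgebra_iff _ _).1 (p.coeff (p.natDegree - i)).2 i, ?_⟩
    rw [Finset.sum_range_succ, ← Finset.sum_range_reflect] at h'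
    have hlast : (p.coeff p.natDegree : Polynomial R) = 1 := by
      have : p.coeff p.natDegree = 1 := hp
      rw [this]; rfl
    rw [hlast] at h'
    simp only [Nat.sub_self, Polynomial.coeff_one_zero, one_mul] at h'
    rw [add_comm, ← h']
    congr 1
    rw [← Finset.Ico_add_one_right_eq_Icc, Finset.sum_Ico_eq_sum_range]
    refine Finset.sum_congr (by simp) fun i hi => ?_
    rw [Finset.mem_range] at hi
    have e1 : p.natDegree - 1 - i = p.natDegree - (1 + i) := by omega
    have e2 : p.natDegree - (p.natDegree - (1 + i)) = 1 + i := by omega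
    rw [e1, e2]

/-- The integral closure of the ideal `I`: the ideal of all elements integral over `I`. -/
def idealIntegralClosure (I : Ideal R) : Ideal R where
  carrier := {a | IsIntegralOverIdeal I a}
  zero_mem' := by
    simp only [Set.mem_ofPred_eq, isIntegralOverIdeal_iff, map_zero]
    exact isIntegral_zero
  add_mem' := by
    intro a b ha hb
    simp only [Set.mem_ofPred_eq, isIntegralOverIdeal_iff, map_add] at *
    exact ha.add hb
  smul_mem' := by
    intro r a ha
    simp only [Set.mem_ofPred_eq, isIntegralOverIdeal_iff] at *
    have : Polynomial.monomial 1 (r • a) =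
        algebraMap (reesAlgebra I) (Polynomial R) (algebraMap R (reesAlgebra I) r) *
          Polynomial.monomial 1 a := by
      change _ = Polynomial.C r * _
      rw [Polynomial.C_mul_monomial, smul_eq_mul]
    rw [this]
    exact isIntegral_algebraMap.mul ha

end IntegralClosure

/-- The depth of a local ring: the supremum of the lengths of the regular sequences
contained in its maximal ideal. -/
noncomputable def localRingDepth (A : Type*) [CommRing A] [IsLocalRing A] : ℕ∞ :=
  ⨆ (rs : List A) (_ : ∀ r ∈ rs, r ∈ IsLocalRing.maximalIdeal A)
    (_ : RingTheory.Sequence.IsRegular A rs), (rs.length : ℕ∞)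

/-- A Noetherian ring is Cohen–Macaulay if depth and Krull dimension agree for each of its
localizations at a maximal ideal (in particular the zero ring is Cohen–Macaulay). -/
def IsCohenMacaulay (A : Type*) [CommRing A] : Prop :=
  IsNoetherianRing A ∧ ∀ (m : Ideal A) [m.IsMaximal],
    (localRingDepth (Localization.AtPrime m) : WithBot ℕ∞) =
      ringKrullDim (Localization.AtPrime m)

/-- The ideal `I` has embedded primes: some associated prime of `A ⧸ I` is not minimal among
the primes containing `I`. -/
def HasEmbeddedPrimes {A : Type*} [CommRing A] (I : Ideal A) : Prop :=
  ∃ P ∈ associatedPrimes A (A ⧸ I), P ∉ I.minimalPrimes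

/-- The monomial ideal `M_{n,t}` of `K[x₁, …, xₙ]`, generated by the `n` monomials
`∏_{j ≠ i} xⱼ ^ t`. -/
noncomputable def idealM (K : Type*) [Field K] (n t : ℕ) : Ideal (MvPolynomial (Fin n) K) :=
  Ideal.span (Set.range fun i : Fin n => ∏ j ∈ Finset.univ.erase i, (X j : MvPolynomial (Fin n) K) ^ t)

/-!
Let `R = K[X₁, …, Xₙ]` and `M = M_{n,t}`.

*Cohen–Macaulayness.* For `y k = X k ^ t` the ideal satisfies `M_k = y_k M_{k-1} + (y₁ ⋯ y_{k-1})`,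
which gives an exact sequence `0 → R ⧸ M_{k-1} → R ⧸ M_k → R ⧸ (y_k, y₁ ⋯ y_{k-1}) → 0`. Sequences
of the same kind filter the last module, so that `R ⧸ M` has a filtration whose factors are of the
form `R ⧸ (X i, X j)` with `i ≠ j` (`StableUnderColon.idealM`). It is therefore enough to find, for
each maximal ideal `p` above `M`, elements `θ₁, …, θ_{n-2}` of `p` that form a regular sequence on
the localization at `p` of every one of these factors, since the dimension of `R ⧸ M` is at most
`n - 2` (`ringKrullDim_quotient_idealM_le`). Take a monic polynomial `g` in one variable with
`g(0) = 0` and `g(X l) ∈ p` for all `l`, and let `θ_k` be the `k`-th elementary symmetric function of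
the `g(X l)`. Modulo `(X i, X j)` two of the `g(X l)` vanish and the other `n - 2` form a regular
sequence (`isWeaklyRegular_aeval_X`), which over a local ring makes their elementary symmetric
functions a regular sequence (`isWeaklyRegular_elemSymm`). Elementary symmetric functions treat all
pairs `i, j` alike, and they work over finite fields as well, where general linear forms may be
missing.

*Embedded primes.* The monomial with exponent vector `v` is integral over `M` as soon as
`∑ max(0, t - v i) ≤ t` (`prod_X_pow_mem_idealIntegralClosure`). In the other direction, the
generators of `M` have order at least `2t` along the linear subspace `X a = X b = X c = 0`, and this
bound carries over to the integral closure (`pow_dvd_of_isIntegralOverIdeal`). For the monomial `w`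
with exponents `t - 1, t - 1, 1` at `a, b, c` and `t` elsewhere, of order `2t - 1`, the two facts show
that its annihilator modulo the integral closure is `(X a, X b, X c)`, which properly contains the
prime `(X a, X b)` above `M`.
-/

/-! ### Regular sequences on extensions and elementary symmetric functions -/

open RingTheory.Sequence in
/-- A sequence that is weakly regular on both ends of a short exact sequence of modules is weakly
regular on the middle term: if `r` is regular on `M₃`, then the sequence stays exact modulo `r`. -/
theorem isWeaklyRegular_of_exact {R M₁ M₂ M₃ : Type*} [CommRing R]
    [AddCommGroup M₁] [AddCommGroup M₂] [AddCommGroup M₃] [Module R M₁] [Module R M₂]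
    [Module R M₃] (rs : List R) (f : M₁ →ₗ[R] M₂) (g : M₂ →ₗ[R] M₃)
    (hf : Function.Injective f) (hfg : Function.Exact f g) (hg : Function.Surjective g)
    (h₁ : IsWeaklyRegular M₁ rs) (h₃ : IsWeaklyRegular M₃ rs) : IsWeaklyRegular M₂ rs := by
  induction rs generalizing M₁ M₂ M₃ with
  | nil => exact .nil R M₂
  | cons r rs ih =>
    rw [isWeaklyRegular_cons_iff] at h₁ h₃ ⊢
    have hzero : Function.Exact (0 : PUnit.{1} →ₗ[R] M₁) f := by
      intro x
      simp only [LinearMap.zero_apply, Set.mem_range, exists_const]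
      rw [map_eq_zero_iff f hf, eq_comm]
    refine ⟨isSMulRegular_of_range_eq_ker hf hfg.linearMap_ker_eq.symm h₁.1 h₃.1, ?_⟩
    refine ih (QuotSMulTop.map r f) (QuotSMulTop.map r g) ?_
      (QuotSMulTop.map_exact r hfg hg) (QuotSMulTop.map_surjective r hg) h₁.2 h₃.2
    have := QuotSMulTop.map_first_exact_on_four_term_exact_of_isSMulRegular_last
      hzero hfg h₃.1
    rw [← LinearMap.ker_eq_bot, this.linearMap_ker_eq]
    simp

/-- The value at `z` of the elementary symmetric polynomial of degree `k`. -/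
def elemSymm {ι S : Type*} [Fintype ι] [CommRing S] (z : ι → S) (k : ℕ) : S :=
  ∑ T ∈ Finset.univ.powersetCard k, ∏ i ∈ T, z i

theorem map_elemSymm {ι S S' : Type*} [Fintype ι] [CommRing S] [CommRing S'] (φ : S →+* S')
    (z : ι → S) (k : ℕ) : φ (elemSymm z k) = elemSymm (fun i => φ (z i)) k := by
  simp [elemSymm, map_sum, map_prod]

theorem elemSymm_mem {ι S : Type*} [Fintype ι] [CommRing S] (I : Ideal S) (z : ι → S)
    (hz : ∀ i, z i ∈ I) (k : ℕ) : elemSymm z (k + 1) ∈ I := by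
  refine I.sum_mem fun T hT => ?_
  obtain ⟨i, hi⟩ := Finset.card_pos.1 (by
    rw [(Finset.mem_powersetCard.1 hT).2]; exact k.succ_pos)
  exact I.mem_of_dvd (Finset.dvd_prod_of_mem z hi) (hz i)

/-- If all `z i` with `i ∉ U` kill the module `N`, then the elementary symmetric function of degree
`|U|` acts on `N` as the product of the `z i` with `i ∈ U`. -/
theorem elemSymm_card_smul {ι S N : Type*} [Fintype ι] [CommRing S] [AddCommGroup N] [Module S N]
    (z : ι → S) (U : Finset ι) (hz : ∀ i, i ∉ U → ∀ x : N, z i • x = 0) (x : N) :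
    elemSymm z U.card • x = (∏ i ∈ U, z i) • x := by
  classical
  rw [elemSymm, Finset.sum_smul]
  refine Finset.sum_eq_single_of_mem U (by simp) fun T hT hTU => ?_
  have hcard := (Finset.mem_powersetCard.1 hT).2
  obtain ⟨i, hiT, hiU⟩ := Finset.not_subset.1 fun h : T ⊆ U =>
    hTU (Finset.eq_of_subset_of_card_le h hcard.ge)
  rw [← Finset.prod_erase_mul _ _ hiT, mul_smul, hz i hiU, smul_zero]

theorem isSMulRegular_finset_prod {ι S N : Type*} [CommRing S] [AddCommGroup N] [Module S N]
    (z : ι → S) (U : Finset ι) (h : ∀ i ∈ U, IsSMulRegular N (z i)) :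
    IsSMulRegular N (∏ i ∈ U, z i) := by
  classical
  induction U using Finset.induction_on with
  | empty => simp
  | insert a s ha ih =>
    rw [Finset.prod_insert ha]
    exact (h a (by simp)).mul (ih fun i hi => h i (by simp [hi]))

open RingTheory.Sequence in
/-- Let `z` be a family in the maximal ideal such that `z i` kills `N` for `i ∉ U` and the `z i` with
`i ∈ U` form a weakly regular sequence on `N`. Then the elementary symmetric functions of the whole
family of degrees `1, …, |U|` form a weakly regular sequence on `N`. The point is that this sequence
does not depend on `U`, so that it serves several modules at once. The proof is by induction on
`|U|`: the last function acts as the product of the `z u`, so it suffices to replace it by each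
`z u`, which can be moved to the front of the sequence and divided out. -/
theorem isWeaklyRegular_elemSymm {ι S N : Type*} [Fintype ι] [CommRing S] [IsLocalRing S]
    [IsNoetherianRing S] [AddCommGroup N] [Module S N] [Module.Finite S N]
    (z : ι → S) (hm : ∀ i, z i ∈ IsLocalRing.maximalIdeal S) (U : Finset ι)
    (hz : ∀ i, i ∉ U → ∀ x : N, z i • x = 0) (hU : IsWeaklyRegular N (U.toList.map z)) :
    IsWeaklyRegular N ((List.range U.card).map fun k => elemSymm z (k + 1)) := by
  classical
  induction hd : U.card generalizing N U with
  | zero => simp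
  | succ d ih =>
    have hmem : ∀ r ∈ (List.range d).map fun k => elemSymm z (k + 1),
        r ∈ IsLocalRing.maximalIdeal S := by
      intro r hr
      obtain ⟨k, -, rfl⟩ := List.mem_map.1 hr
      exact elemSymm_mem _ z hm k
    have key : ∀ u ∈ U, IsWeaklyRegular N
        (((List.range d).map fun k => elemSymm z (k + 1)) ++ [z u]) := by
      intro u hu
      have hperm : (U.toList.map z).Perm (z u :: (U.erase u).toList.map z) := by
        rw [← List.map_cons]
        refine List.Perm.map z ?_
        have := Finset.toList_insert (Finset.notMem_erase u U)
        rwa [Finset.insert_erase hu] at this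
      have h1 := IsLocalRing.isWeaklyRegular_of_perm_of_subset_maximalIdeal hU hperm (by
        intro r hr
        obtain ⟨i, -, rfl⟩ := List.mem_map.1 hr
        exact hm i)
      rw [isWeaklyRegular_cons_iff] at h1
      refine IsLocalRing.isWeaklyRegular_of_perm_of_subset_maximalIdeal
        (.cons h1.1 (ih (U.erase u) ?_ h1.2 (by rw [Finset.card_erase_of_mem hu, hd]; rfl)))
        (List.perm_append_singleton _ _).symm ?_
      · intro i hi x
        obtain ⟨y, rfl⟩ := Submodule.mkQ_surjective _ x
        rw [← map_smul]
        by_cases hiu : i = u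
        · subst hiu
          exact (Submodule.Quotient.mk_eq_zero _).2
            (Submodule.smul_mem_pointwise_smul y _ ⊤ trivial)
        · rw [hz i (fun h => hi (Finset.mem_erase.2 ⟨hiu, h⟩)), map_zero]
      · intro r hr
        rcases List.mem_cons.1 hr with rfl | hr
        exacts [hm u, hmem r hr]
    obtain ⟨u, hu⟩ := Finset.card_pos.1 (by omega : 0 < U.card)
    rw [List.range_succ, List.map_append, List.map_singleton, isWeaklyRegular_append_iff,
      isWeaklyRegular_singleton_iff]
    refine ⟨((isWeaklyRegular_append_iff _ _ _).1 (key u hu)).1, ?_⟩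
    have hreg := isSMulRegular_finset_prod (N := N ⧸ (Ideal.ofList
        ((List.range d).map fun k => elemSymm z (k + 1)) • ⊤ : Submodule S N)) z U fun i hi =>
      (isWeaklyRegular_singleton_iff _ _).1 ((isWeaklyRegular_append_iff _ _ _).1 (key i hi)).2
    -- On this quotient `elemSymm z (d + 1)` acts as the product over `U`.
    have hsm : ∀ x : N ⧸ (Ideal.ofList
        ((List.range d).map fun k => elemSymm z (k + 1)) • ⊤ : Submodule S N),
        elemSymm z (d + 1) • x = (∏ i ∈ U, z i) • x := by
      intro x
      rw [← hd]
      refine elemSymm_card_smul z U (fun i hi x => ?_) x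
      obtain ⟨y, rfl⟩ := Submodule.mkQ_surjective _ x
      rw [← map_smul, hz i hi, map_zero]
    intro x y hxy
    refine hreg ?_
    simpa only [hsm] using hxy

/-! ### Monic polynomials in distinct variables -/

/-- A monic polynomial in the variable `X k` is a nonzerodivisor modulo polynomials that involve one
of the other variables each: modulo those, the ring is a polynomial ring in `X k` over a quotient of
the polynomial ring in the other variables. -/
theorem mem_span_of_aeval_X_mul_mem {σ K : Type*} [Field K] (f : σ → Polynomial K) (L : Set σ)
    (k : σ) (hk : k ∉ L) (hf : (f k).Monic) (p : MvPolynomial σ K)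
    (hp : Polynomial.aeval (X k) (f k) * p ∈
      Ideal.span ((fun l => Polynomial.aeval (X l : MvPolynomial σ K) (f l)) '' L)) :
    p ∈ Ideal.span ((fun l => Polynomial.aeval (X l : MvPolynomial σ K) (f l)) '' L) := by
  classical
  let Q := MvPolynomial {l // l ≠ k} K
  let e : MvPolynomial σ K ≃ₐ[K] Polynomial Q :=
    (renameEquiv K (Equiv.optionSubtypeNe k).symm).trans (optionEquivLeft K _)
  have heX : ∀ l (h : l ≠ k), e (X l) = Polynomial.C (X ⟨l, h⟩) := by
    intro l h
    simp only [e, AlgEquiv.trans_apply, renameEquiv_apply, rename_X,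
      Equiv.optionSubtypeNe_symm_of_ne h]
    exact optionEquivLeft_X_some K _ _
  have hek : e (X k) = Polynomial.X := by
    simp only [e, AlgEquiv.trans_apply, renameEquiv_apply, rename_X,
      Equiv.optionSubtypeNe_symm_self]
    exact optionEquivLeft_X_none K _
  let I' : Ideal Q := Ideal.span
    ((fun l : {l // l ≠ k} => Polynomial.aeval (X l : Q) (f l)) '' {l | (l : σ) ∈ L})
  have hI : (Ideal.span ((fun l => Polynomial.aeval (X l : MvPolynomial σ K) (f l)) '' L)).map
      (e : MvPolynomial σ K →+* Polynomial Q) = I'.map Polynomial.C := by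
    rw [Ideal.map_span, Ideal.map_span, Set.image_image, Set.image_image]
    congr 1
    have hval : ∀ l (h : l ≠ k), e (Polynomial.aeval (X l) (f l)) =
        Polynomial.C (Polynomial.aeval (X ⟨l, h⟩ : Q) (f l)) := by
      intro l h
      have h2 : (Polynomial.C (Polynomial.aeval (X ⟨l, h⟩ : Q) (f l)) : Polynomial Q) =
        Polynomial.aeval (Polynomial.C (X ⟨l, h⟩ : Q)) (f l) :=
        (Polynomial.aeval_algHom_apply (Polynomial.CAlgHom (R := K) (A := Q)) (X ⟨l, h⟩ : Q) (f l)).symm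
      rw [h2, ← heX l h]
      exact (Polynomial.aeval_algHom_apply e.toAlgHom (X l) (f l)).symm
    ext q
    constructor
    · rintro ⟨l, hl, rfl⟩
      have h : l ≠ k := fun h => hk (h ▸ hl)
      exact ⟨⟨l, h⟩, hl, (hval l h).symm⟩
    · rintro ⟨⟨l, h⟩, hl, rfl⟩
      exact ⟨l, hl, hval l h⟩
  have hmem : ∀ q, q ∈ Ideal.span ((fun l => Polynomial.aeval (X l : MvPolynomial σ K) (f l)) '' L)
      ↔ Polynomial.map (Ideal.Quotient.mk I') (e q) = 0 := by
    intro q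
    rw [← Polynomial.coe_mapRingHom, ← RingHom.mem_ker, Polynomial.ker_mapRingHom,
      Ideal.mk_ker, ← hI]
    constructor
    · exact fun hq => Ideal.mem_map_of_mem _ hq
    · intro hq
      obtain ⟨q', hq', h⟩ := (Ideal.mem_map_of_equiv e _).1 hq
      rwa [← e.injective h]
  rw [hmem] at hp ⊢
  have hfk : Polynomial.map (Ideal.Quotient.mk I') (e (Polynomial.aeval (X k) (f k))) =
      (f k).map ((Ideal.Quotient.mk I').comp (algebraMap K Q)) := by
    have : e (Polynomial.aeval (X k) (f k)) = Polynomial.aeval (e (X k)) (f k) :=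
      (Polynomial.aeval_algHom_apply e.toAlgHom (X k) (f k)).symm
    rw [this, hek, ← Polynomial.map_map]
    rw [← Polynomial.aeval_map_algebraMap Q, Polynomial.aeval_X_left_apply]
  rw [map_mul, Polynomial.map_mul, hfk] at hp
  exact ((hf.map _).mul_right_eq_zero_iff).1 hp

open RingTheory.Sequence in
theorem isWeaklyRegular_aeval_X {σ K : Type*} [Field K] (f : σ → Polynomial K)
    (hf : ∀ l, (f l).Monic) (L : List σ) (hL : L.Nodup) :
    IsWeaklyRegular (MvPolynomial σ K)
      (L.map fun l => Polynomial.aeval (X l : MvPolynomial σ K) (f l)) := by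
  refine ⟨fun i hi => ?_⟩
  rw [List.length_map] at hi
  rw [isSMulRegular_quotient_iff_mem_of_smul_mem]
  intro p hp
  have hspan : (Ideal.ofList ((L.map fun l => Polynomial.aeval (X l : MvPolynomial σ K) (f l)).take i)
      • ⊤ : Ideal (MvPolynomial σ K)) =
      Ideal.span ((fun l => Polynomial.aeval (X l : MvPolynomial σ K) (f l)) ''
        {l | l ∈ L.take i}) := by
    rw [smul_eq_mul, Ideal.mul_top, Ideal.ofList]
    congr 1
    ext q
    simp [← List.map_take]
  rw [hspan] at hp ⊢
  rw [List.getElem_map, smul_eq_mul] at hp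
  refine mem_span_of_aeval_X_mul_mem f _ L[i] ?_ (hf _) p hp
  intro h
  obtain ⟨j, hj, hji⟩ := List.mem_take_iff_getElem.1 h
  have := (hL.getElem_inj_iff).1 hji
  omega

/-! ### Ideals reached from pairs of variables by colon extensions -/

/-- A predicate on ideals is stable under colon extensions if it holds for `I` as soon as it holds
for `I + (a)` and `I : a`, for some element `a`. -/
def StableUnderColon {R : Type*} [CommRing R] (Q : Ideal R → Prop) : Prop :=
  ∀ (I J : Ideal R) (a : R), (∀ r, a * r ∈ I ↔ r ∈ J) → Q J → Q (I ⊔ Ideal.span {a}) → Q I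

namespace StableUnderColon

/-- If `y` and `a` have no common factor, then `(y, a * b) : a = (y, b)`, and
`(y, a * b) + (a) = (y, a)`. -/
theorem span_pair_mul {R : Type*} [CommRing R] [DecompositionMonoid R] {Q : Ideal R → Prop}
    (hQ : StableUnderColon Q) {y a b : R} (hya : IsRelPrime y a)
    (ha : Q (Ideal.span {y, a})) (hb : Q (Ideal.span {y, b})) : Q (Ideal.span {y, a * b}) := by
  refine hQ _ (Ideal.span {y, b}) a (fun r => ?_) hb ?_
  · simp only [Ideal.mem_span_pair]
    constructor
    · rintro ⟨u, v, h⟩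
      obtain ⟨w, hw⟩ := hya.dvd_of_dvd_mul_left
        (⟨u, by linear_combination -h⟩ : y ∣ a * (r - b * v))
      exact ⟨w, v, by linear_combination -hw⟩
    · rintro ⟨u, v, rfl⟩
      exact ⟨a * u, v, by ring⟩
  · convert ha using 1
    rw [← Ideal.span_union]
    refine le_antisymm (Ideal.span_le.2 ?_) (Ideal.span_mono ?_)
    · have h1 : y ∈ Ideal.span {y, a} := Ideal.subset_span (by simp)
      have h2 : a ∈ Ideal.span {y, a} := Ideal.subset_span (by simp)
      rintro _ ((rfl | rfl) | rfl)
      exacts [h1, Ideal.mul_mem_right _ _ h2, h2]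
    · rintro _ (rfl | rfl) <;> simp

theorem span_pair_prod {R ι : Type*} [CommRing R] [DecompositionMonoid R] {Q : Ideal R → Prop}
    (hQ : StableUnderColon Q) (htop : Q ⊤) (y : R) (f : ι → R) (s : Finset ι)
    (hrel : ∀ i ∈ s, IsRelPrime y (f i)) (h : ∀ i ∈ s, Q (Ideal.span {y, f i})) :
    Q (Ideal.span {y, ∏ i ∈ s, f i}) := by
  classical
  induction s using Finset.induction_on with
  | empty =>
    convert htop
    exact (Ideal.eq_top_iff_one _).2 (Ideal.subset_span (by simp))
  | insert a s ha ih =>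
    rw [Finset.prod_insert ha]
    exact hQ.span_pair_mul (hrel a (by simp)) (h a (by simp))
      (ih (fun i hi => hrel i (by simp [hi])) fun i hi => h i (by simp [hi]))

theorem span_pair_pow_right {R : Type*} [CommRing R] [DecompositionMonoid R] {Q : Ideal R → Prop}
    (hQ : StableUnderColon Q) (htop : Q ⊤) (y a : R) (hya : IsRelPrime y a)
    (h : Q (Ideal.span {y, a})) (t : ℕ) : Q (Ideal.span {y, a ^ t}) := by
  simpa using hQ.span_pair_prod htop y (fun _ : ℕ => a) (Finset.range t)
    (fun _ _ => hya) (fun _ _ => h)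

theorem span_pair_pow_pow {R : Type*} [CommRing R] [DecompositionMonoid R] {Q : Ideal R → Prop}
    (hQ : StableUnderColon Q) (htop : Q ⊤) (y a : R) (hya : IsRelPrime y a)
    (h : Q (Ideal.span {y, a})) (s t : ℕ) : Q (Ideal.span {y ^ s, a ^ t}) := by
  have h1 := hQ.span_pair_pow_right htop y a hya h t
  rw [Ideal.span_pair_comm] at h1 ⊢
  exact hQ.span_pair_pow_right htop _ _ hya.symm.pow_left h1 s

/-- The ideal generated by the products of all but one of the elements `y i`, `i ∈ s`, is reached
from the pairs `(y i, y j)` by colon extensions. When `k` is added to `s`, the ideal `I` becomes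
`y k • I + (∏ j ∈ s, y j)`, whose colon ideal by `y k` is `I` and whose sum with `(y k)` is
`(y k, ∏ j ∈ s, y j)`. -/
theorem span_prod_erase {R ι : Type*} [CommRing R] [IsDomain R] [DecompositionMonoid R]
    [DecidableEq ι] {Q : Ideal R → Prop} (hQ : StableUnderColon Q) (htop : Q ⊤) (y : ι → R)
    (hrel : ∀ i j, i ≠ j → IsRelPrime (y i) (y j)) (hy : ∀ i, y i ≠ 0)
    (h : ∀ i j, i ≠ j → Q (Ideal.span {y i, y j})) (s : Finset ι) (hs : s.Nonempty) :
    Q (Ideal.span ((fun i => ∏ j ∈ s.erase i, y j) '' s)) := by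
  induction hs using Finset.Nonempty.cons_induction with
  | singleton a =>
    convert htop
    exact (Ideal.eq_top_iff_one _).2 (Ideal.subset_span (by simp))
  | cons k s hk hs ih =>
    have hspan : Ideal.span ((fun i => ∏ j ∈ (s.cons k hk).erase i, y j) '' (s.cons k hk : Finset ι))
        = Ideal.span {y k} * Ideal.span ((fun i => ∏ j ∈ s.erase i, y j) '' s) ⊔
          Ideal.span {∏ j ∈ s, y j} := by
      rw [Ideal.span_mul_span', Set.singleton_mul, Set.image_image, sup_comm, ← Ideal.span_union]
      congr 1
      rw [Finset.coe_cons, Set.image_insert_eq, Set.singleton_union]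
      congr 1
      · rw [Finset.cons_eq_insert, Finset.erase_insert hk]
      · refine Set.image_congr fun i hi => ?_
        have hik : k ≠ i := fun h => hk (h ▸ hi)
        rw [Finset.cons_eq_insert, Finset.erase_insert_of_ne hik,
          Finset.prod_insert (by simp [hk])]
    have hprod : ∏ j ∈ s, y j ∈ Ideal.span ((fun i => ∏ j ∈ s.erase i, y j) '' s) := by
      obtain ⟨i, hi⟩ := hs
      rw [← Finset.mul_prod_erase _ _ hi]
      exact Ideal.mul_mem_left _ _ (Ideal.subset_span ⟨i, hi, rfl⟩)
    rw [hspan]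
    refine hQ _ _ (y k) (fun r => ?_) ih ?_
    · constructor
      · intro hr
        obtain ⟨a, ha, b, hb, hab⟩ := Submodule.mem_sup.1 hr
        obtain ⟨m, hm, rfl⟩ := Ideal.mem_span_singleton_mul.1 ha
        obtain ⟨v, rfl⟩ := Ideal.mem_span_singleton.1 hb
        have hkp : IsRelPrime (y k) (∏ j ∈ s, y j) :=
          IsRelPrime.prod_right fun j hj => hrel k j fun h => hk (h ▸ hj)
        obtain ⟨w, rfl⟩ := hkp.dvd_of_dvd_mul_left
          (⟨r - m, by linear_combination hab⟩ : y k ∣ (∏ j ∈ s, y j) * v)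
        have : r = m + (∏ j ∈ s, y j) * w :=
          mul_left_cancel₀ (hy k) (by linear_combination -hab)
        rw [this]
        exact Ideal.add_mem _ hm (Ideal.mul_mem_right _ _ hprod)
      · intro hr
        exact Submodule.mem_sup_left (Ideal.mul_mem_mul (Ideal.mem_span_singleton_self _) hr)
    · have hpair := hQ.span_pair_prod htop (y k) y s
        (fun i hi => hrel k i fun h => hk (h ▸ hi)) (fun i hi => h k i fun h => hk (h ▸ hi))
      convert hpair using 1
      rw [sup_assoc, ← Ideal.span_union, Set.singleton_union, Set.pair_comm]
      refine sup_eq_right.2 (Ideal.mul_le_left.trans (Ideal.span_mono ?_))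
      rw [Set.singleton_subset_iff]
      exact Set.mem_insert _ _

end StableUnderColon

theorem isRelPrime_X {σ K : Type*} [Field K] {i j : σ} (h : i ≠ j) :
    IsRelPrime (X i : MvPolynomial σ K) (X j) :=
  (X_prime (R := K) (i := i)).irreducible.isRelPrime_iff_not_dvd.2 fun hd => h (by
    simpa using hd)

theorem StableUnderColon.idealM {K : Type*} [Field K] {n : ℕ} (hn : 1 ≤ n) (t : ℕ)
    {Q : Ideal (MvPolynomial (Fin n) K) → Prop} (hQ : StableUnderColon Q) (htop : Q ⊤)
    (h : ∀ i j, i ≠ j → Q (Ideal.span {X i, X j})) : Q (idealM K n t) := by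
  have := hQ.span_prod_erase htop (fun i => (X i : MvPolynomial (Fin n) K) ^ t)
    (fun i j hij => (isRelPrime_X hij).pow) (fun i => pow_ne_zero _ (X_ne_zero i))
    (fun i j hij => hQ.span_pair_pow_pow htop _ _ (isRelPrime_X hij) (h i j hij) t t)
    Finset.univ ⟨⟨0, hn⟩, Finset.mem_univ _⟩
  rwa [Finset.coe_univ, Set.image_univ] at this

/-! ### The Cohen–Macaulay property -/

open RingTheory.Sequence in
/-- The exact sequence `0 → R ⧸ (I : a) → R ⧸ I → R ⧸ (I + (a)) → 0` and its localization show that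
regularity of a given sequence is stable under colon extensions. -/
theorem stableUnderColon_isWeaklyRegular {R : Type*} [CommRing R] (S : Submonoid R)
    (rs : List (Localization S)) :
    StableUnderColon fun I : Ideal R => IsWeaklyRegular (LocalizedModule S (R ⧸ I)) rs := by
  intro I J a hIJ hJ hIa
  let f : (R ⧸ J) →ₗ[R] (R ⧸ I) := J.mapQ I (LinearMap.mulLeft R a) fun r hr => (hIJ r).2 hr
  let g : (R ⧸ I) →ₗ[R] (R ⧸ (I ⊔ Ideal.span {a})) := Submodule.factor le_sup_left
  have hf : Function.Injective f := by
    rw [injective_iff_map_eq_zero]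
    intro x hx
    obtain ⟨r, rfl⟩ := J.mkQ_surjective x
    exact (Submodule.Quotient.mk_eq_zero _).2
      ((hIJ r).1 ((Submodule.Quotient.mk_eq_zero _).1 hx))
  have hg : Function.Surjective g := Submodule.factor_surjective _
  have hfg : Function.Exact f g := by
    intro x
    obtain ⟨r, rfl⟩ := I.mkQ_surjective x
    constructor
    · intro hx
      obtain ⟨i, hi, b, hb, rfl⟩ := Submodule.mem_sup.1 ((Submodule.Quotient.mk_eq_zero _).1 hx)
      obtain ⟨c, rfl⟩ := Ideal.mem_span_singleton.1 hb
      refine ⟨J.mkQ c, ?_⟩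
      refine (Submodule.Quotient.eq _).2 ?_
      simpa using hi
    · rintro ⟨y, hy⟩
      obtain ⟨c, rfl⟩ := J.mkQ_surjective y
      rw [← hy]
      exact (Submodule.Quotient.mk_eq_zero _).2
        (Submodule.mem_sup_right (Ideal.mul_mem_right _ _ (Ideal.mem_span_singleton_self a)))
  exact isWeaklyRegular_of_exact rs (LocalizedModule.map S f) (LocalizedModule.map S g)
    (LocalizedModule.map_injective S f hf) (LocalizedModule.map_exact S f g hfg)
    (LocalizedModule.map_surjective S g hg) hJ hIa

theorem exists_mem_of_idealM_le {K : Type*} [Field K] {n t : ℕ} (hn : 1 ≤ n)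
    (p : Ideal (MvPolynomial (Fin n) K)) [hp : p.IsPrime] (h : idealM K n t ≤ p) :
    ∃ i j, i ≠ j ∧ (X i : MvPolynomial (Fin n) K) ∈ p ∧ (X j : MvPolynomial (Fin n) K) ∈ p := by
  have hgen : ∀ i, ∃ j, j ≠ i ∧ (X j : MvPolynomial (Fin n) K) ∈ p := by
    intro i
    obtain ⟨j, hj, hjp⟩ := hp.prod_mem_iff.1 (h (Ideal.subset_span ⟨i, rfl⟩))
    exact ⟨j, (Finset.mem_erase.1 hj).1, hp.mem_of_pow_mem _ hjp⟩
  obtain ⟨i, -, hi⟩ := hgen ⟨0, hn⟩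
  obtain ⟨j, hji, hj⟩ := hgen i
  exact ⟨i, j, hji.symm, hi, hj⟩

/-- A chain of primes above `M_{n,t}` starts with a prime that contains two variables `X i`, `X j`, so
it can be extended downwards by `(X i)` and `0`. -/
theorem ringKrullDim_quotient_idealM_le {K : Type*} [Field K] {n t : ℕ} (hn : 1 ≤ n) :
    ringKrullDim (MvPolynomial (Fin n) K ⧸ idealM K n t) ≤ ((n - 2 : ℕ) : WithBot ℕ∞) := by
  rw [ringKrullDim_quotient]
  refine iSup_le fun s => ?_
  let q : LTSeries (PrimeSpectrum (MvPolynomial (Fin n) K)) := s.map Subtype.val fun _ _ h => h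
  have hM : idealM K n t ≤ q.head.asIdeal := s.head.2
  obtain ⟨i, j, hij, hi, hj⟩ := exists_mem_of_idealM_le hn q.head.asIdeal hM
  let p₀ : PrimeSpectrum (MvPolynomial (Fin n) K) := ⟨⊥, Ideal.isPrime_bot⟩
  let p₁ : PrimeSpectrum (MvPolynomial (Fin n) K) :=
    ⟨Ideal.span {X i}, (Ideal.span_singleton_prime (X_ne_zero i)).2 X_prime⟩
  have h₁ : p₁ < q.head := by
    refine lt_of_le_of_ne ((Ideal.span_singleton_le_iff_mem _).2 hi) fun h => hij ?_
    have : (X j : MvPolynomial (Fin n) K) ∈ p₁.asIdeal := h ▸ hj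
    simpa using Ideal.mem_span_singleton.1 this
  have h₀ : p₀ < p₁ := by
    refine lt_of_le_of_ne (bot_le (a := p₁.asIdeal)) fun h => X_ne_zero (R := K) i ?_
    have : (X i : MvPolynomial (Fin n) K) ∈ p₀.asIdeal := h ▸ Ideal.mem_span_singleton_self _
    exact this
  let q₁ : LTSeries (PrimeSpectrum (MvPolynomial (Fin n) K)) := q.cons p₁ h₁
  let q₀ : LTSeries (PrimeSpectrum (MvPolynomial (Fin n) K)) := q₁.cons p₀ h₀
  have hlen₁ : q₁.length = s.length + 1 := RelSeries.cons_length q p₁ h₁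
  have hlen₀ : q₀.length = q₁.length + 1 := RelSeries.cons_length q₁ p₀ h₀
  have hlen := Order.LTSeries.length_le_krullDim q₀
  rw [← ringKrullDim, MvPolynomial.ringKrullDim_of_isNoetherianRing,
    ringKrullDim_eq_zero_of_field, zero_add, Nat.card_eq_fintype_card, Fintype.card_fin,
    hlen₀, hlen₁] at hlen
  have hlen' : s.length + 1 + 1 ≤ n := by exact_mod_cast hlen
  exact_mod_cast (by omega : s.length ≤ n - 2)

/-- By the Nullstellensatz the residue field of a maximal ideal is finite over `K`, so a product of
minimal polynomials takes all variables into the ideal; a factor `X` can be added at will. -/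
theorem exists_monic_aeval_X_mem {σ K : Type*} [Finite σ] [Field K]
    (p : Ideal (MvPolynomial σ K)) [p.IsMaximal] :
    ∃ g : Polynomial K, g.Monic ∧ Polynomial.X ∣ g ∧
      ∀ l, Polynomial.aeval (X l : MvPolynomial σ K) g ∈ p := by
  have := Fintype.ofFinite σ
  let _ : Field (MvPolynomial σ K ⧸ p) := Ideal.Quotient.field p
  have hfin : Module.Finite K (MvPolynomial σ K ⧸ p) :=
    finite_of_finite_type_of_isJacobsonRing K _
  have hint : ∀ l, IsIntegral K (Ideal.Quotient.mk p (X l)) := fun l => IsIntegral.of_finite K _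
  refine ⟨Polynomial.X * ∏ l, minpoly K (Ideal.Quotient.mk p (X l)),
    Polynomial.monic_X.mul (Polynomial.monic_prod_of_monic _ _ fun l _ => minpoly.monic (hint l)),
    Dvd.intro _ rfl, fun l => ?_⟩
  rw [map_mul, map_prod]
  refine Ideal.mul_mem_left _ _ (p.mem_of_dvd (Finset.dvd_prod_of_mem _ (Finset.mem_univ l)) ?_)
  rw [← Ideal.Quotient.eq_zero_iff_mem]
  have := Polynomial.aeval_algHom_apply (Ideal.Quotient.mkₐ K p) (X l)
    (minpoly K (Ideal.Quotient.mk p (X l)))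
  rw [Ideal.Quotient.mkₐ_eq_mk] at this
  rw [← this, minpoly.aeval]

open RingTheory.Sequence in
/-- The elementary symmetric functions of the `g(X l)`, in degrees up to the number of variables
minus two, are weakly regular on the localization of `K[X] ⧸ (X i, X j)` at `p`. The sequence does
not depend on `i` and `j`. The localization may be zero. -/
theorem isWeaklyRegular_localizedModule_span_pair {σ K : Type*} [Fintype σ] [Field K]
    (p : Ideal (MvPolynomial σ K)) [p.IsPrime] (g : Polynomial K) (hg : g.Monic)
    (hXg : Polynomial.X ∣ g) (hgp : ∀ l, Polynomial.aeval (X l : MvPolynomial σ K) g ∈ p)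
    (i j : σ) (hij : i ≠ j) :
    IsWeaklyRegular
      (LocalizedModule p.primeCompl
        (MvPolynomial σ K ⧸ (Ideal.span {X i, X j} : Ideal (MvPolynomial σ K))))
      (((List.range (Fintype.card σ - 2)).map fun k =>
        elemSymm (fun l => Polynomial.aeval (X l : MvPolynomial σ K) g) (k + 1)).map
          (algebraMap (MvPolynomial σ K) (Localization p.primeCompl))) := by
  classical
  let S := Localization.AtPrime p
  let z : σ → MvPolynomial σ K := fun l => Polynomial.aeval (X l : MvPolynomial σ K) g
  let I : Ideal (MvPolynomial σ K) := Ideal.span {X i, X j}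
  let U : Finset σ := (Finset.univ.erase i).erase j
  have hcard : U.card = Fintype.card σ - 2 := by
    rw [Finset.card_erase_of_mem (by simp [hij.symm]), Finset.card_erase_of_mem (by simp)]
    rfl
  have hzI : ∀ l, l ∉ U → z l ∈ I := by
    intro l hl
    have hXl : (X l : MvPolynomial σ K) ∈ I := by
      have : l = i ∨ l = j := by
        by_contra h
        push Not at h
        exact hl (by simp [U, h.1, h.2])
      rcases this with rfl | rfl <;> exact Ideal.subset_span (by simp)
    refine I.mem_of_dvd ?_ hXl
    simpa using map_dvd (Polynomial.aeval (X l : MvPolynomial σ K)) hXg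
  have hreg : IsWeaklyRegular (MvPolynomial σ K ⧸ I) (U.toList.map z) := by
    -- The sequence `X i, X j, g(X l), …` consists of monic polynomials in distinct variables.
    let f : σ → Polynomial K := fun l => if l ∈ U then g else Polynomial.X
    have h := isWeaklyRegular_aeval_X f (fun l => by
      simp only [f]; split_ifs; exacts [hg, Polynomial.monic_X]) ([i, j] ++ U.toList) (by
        simp [hij, U, Finset.nodup_toList])
    rw [List.map_append, isWeaklyRegular_append_iff] at h
    have h2 := h.2
    have hmap : (U.toList.map fun l => Polynomial.aeval (X l : MvPolynomial σ K) (f l)) =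
        U.toList.map z := by
      refine List.map_congr_left fun l hl => ?_
      simp [f, z, Finset.mem_toList.1 hl]
    rw [hmap] at h2
    refine ((Submodule.quotEquivOfEq _ _ ?_).isWeaklyRegular_congr _).1 h2
    rw [smul_eq_mul, Ideal.mul_top]
    simp only [Ideal.ofList, I]
    congr 1
    ext q
    simp [f, U]
  have hloc := hreg.of_isLocalizedModule (Localization.AtPrime p) p.primeCompl
    (LocalizedModule.mkLinearMap p.primeCompl (MvPolynomial σ K ⧸ I))
  rw [List.map_map] at hloc
  have := isWeaklyRegular_elemSymm (S := Localization.AtPrime p)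
    (N := LocalizedModule p.primeCompl (MvPolynomial σ K ⧸ I))
    (fun l => algebraMap _ (Localization.AtPrime p) (z l))
    (fun l => (IsLocalization.AtPrime.to_map_mem_maximal_iff _ p _).2 (hgp l)) U
    (fun l hl x => ?_) hloc
  · rw [hcard] at this
    rw [List.map_map]
    convert this using 3 with k
    exact map_elemSymm _ _ _
  · induction x using LocalizedModule.induction_on with
    | h m s =>
      obtain ⟨r, rfl⟩ := I.mkQ_surjective m
      rw [algebraMap_smul, LocalizedModule.smul'_mk, ← map_smul]
      have : I.mkQ (z l • r) = 0 :=
        (Submodule.Quotient.mk_eq_zero _).2 (Ideal.mul_mem_right _ _ (hzI l hl))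
      rw [this, LocalizedModule.zero_mk]

open RingTheory.Sequence in
/-- The localization of the ring `R ⧸ I` at a prime `m` is the localization of the `R`-module `R ⧸ I`
at the preimage of `m`. -/
theorem isWeaklyRegular_localization_quotient {R : Type*} [CommRing R] (I : Ideal R)
    (m : Ideal (R ⧸ I)) [m.IsPrime] (rs : List R)
    (h : IsWeaklyRegular (LocalizedModule (m.comap (Ideal.Quotient.mk I)).primeCompl (R ⧸ I))
      (rs.map (algebraMap R (Localization (m.comap (Ideal.Quotient.mk I)).primeCompl)))) :
    IsWeaklyRegular (Localization.AtPrime m) 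
      (rs.map (algebraMap R (Localization.AtPrime m))) := by
  rw [isWeaklyRegular_map_algebraMap_iff] at h ⊢
  have hS : Algebra.algebraMapSubmonoid (R ⧸ I) (m.comap (Ideal.Quotient.mk I)).primeCompl =
      m.primeCompl := by
    ext x
    constructor
    · rintro ⟨r, hr, rfl⟩
      exact hr
    · intro hx
      obtain ⟨r, rfl⟩ := Ideal.Quotient.mk_surjective x
      exact ⟨r, hx, rfl⟩
  have : IsLocalization (Algebra.algebraMapSubmonoid (R ⧸ I)
      (m.comap (Ideal.Quotient.mk I)).primeCompl) (Localization.AtPrime m) := by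
    rw [hS]; infer_instance
  have hloc := isLocalizedModule_iff_isLocalization.2 this
  exact ((IsLocalizedModule.iso _
    (IsScalarTower.toAlgHom R (R ⧸ I) (Localization.AtPrime m)).toLinearMap).isWeaklyRegular_congr
      rs).1 h

open RingTheory.Sequence in
/-- In a Noetherian local ring every regular sequence has length at most the dimension, so one of
length at least the dimension proves equality of depth and dimension. -/
theorem localRingDepth_eq_ringKrullDim {A : Type*} [CommRing A] [IsLocalRing A]
    [IsNoetherianRing A] (d : ℕ) (hd : ringKrullDim A ≤ (d : WithBot ℕ∞)) (rs : List A)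
    (hrs : rs.length = d) (hm : ∀ r ∈ rs, r ∈ IsLocalRing.maximalIdeal A)
    (hreg : IsWeaklyRegular A rs) : (localRingDepth A : WithBot ℕ∞) = ringKrullDim A := by
  have hlen : ∀ l : List A, IsRegular A l → ((l.length : ℕ∞) : WithBot ℕ∞) ≤ ringKrullDim A := by
    intro l hl
    have : Nontrivial (A ⧸ Ideal.ofList l) := by
      rw [Ideal.Quotient.nontrivial_iff]
      simpa using hl.top_ne_smul.symm
    rw [← ringKrullDim_add_length_eq_ringKrullDim_of_isRegular l hl]
    exact le_add_of_nonneg_left ringKrullDim_nonneg_of_nontrivial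
  have hr := IsRegular.of_isWeaklyRegular_of_mem_maximalIdeal A hm hreg
  have hdim : ringKrullDim A = ((d : ℕ∞) : WithBot ℕ∞) :=
    le_antisymm hd (hrs ▸ hlen rs hr)
  rw [hdim, WithBot.coe_inj]
  refine le_antisymm (iSup_le fun l => iSup_le fun _ => iSup_le fun hl => ?_) ?_
  · rw [← WithBot.coe_le_coe, ← hdim]
    exact hlen l hl
  · rw [← hrs]
    exact le_iSup_of_le rs (le_iSup_of_le hm (le_iSup_of_le hr le_rfl))

theorem isCohenMacaulay_quotient_idealM (K : Type*) [Field K] (n t : ℕ) (hn : 1 ≤ n) :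
    IsCohenMacaulay (MvPolynomial (Fin n) K ⧸ idealM K n t) := by
  refine ⟨inferInstance, fun m hm => ?_⟩
  let p := m.comap (Ideal.Quotient.mk (idealM K n t))
  have hp : p.IsMaximal := Ideal.comap_isMaximal_of_surjective _ Ideal.Quotient.mk_surjective
  obtain ⟨g, hg, hXg, hgp⟩ := exists_monic_aeval_X_mem p
  let rs := (List.range (Fintype.card (Fin n) - 2)).map fun k =>
    elemSymm (fun l => Polynomial.aeval (X l : MvPolynomial (Fin n) K) g) (k + 1)
  have hreg := (stableUnderColon_isWeaklyRegular p.primeCompl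
    (rs.map (algebraMap _ (Localization p.primeCompl)))).idealM hn t ?_
    (fun i j hij => isWeaklyRegular_localizedModule_span_pair p g hg hXg hgp i j hij)
  · refine localRingDepth_eq_ringKrullDim (n - 2) ?_ _ ?_ ?_
      (isWeaklyRegular_localization_quotient _ m rs hreg)
    · rw [IsLocalization.AtPrime.ringKrullDim_eq_height m]
      exact (Ideal.height_le_ringKrullDim_of_ne_top hm.ne_top).trans
        (ringKrullDim_quotient_idealM_le hn)
    · simp [rs]
    · intro r hr
      obtain ⟨s, hs, rfl⟩ := List.mem_map.1 hr
      obtain ⟨k, -, rfl⟩ := List.mem_map.1 hs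
      rw [IsScalarTower.algebraMap_apply _ (MvPolynomial (Fin n) K ⧸ idealM K n t),
        IsLocalization.AtPrime.to_map_mem_maximal_iff _ m]
      exact elemSymm_mem p _ hgp k
  · have : Subsingleton (MvPolynomial (Fin n) K ⧸ (⊤ : Ideal (MvPolynomial (Fin n) K))) :=
      Ideal.Quotient.subsingleton_iff.2 rfl
    have hsub : Subsingleton (LocalizedModule p.primeCompl
        (MvPolynomial (Fin n) K ⧸ (⊤ : Ideal (MvPolynomial (Fin n) K)))) := inferInstance
    refine ⟨fun i hi x y _ => ?_⟩
    exact Subsingleton.elim x y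

/-! ### Integral elements over an ideal and embedded primes -/

/-- Valuative bound for integral elements: if `π ^ s` divides the images of all elements of `I`, then
it divides the images of all elements integral over `I`. -/
theorem pow_dvd_of_isIntegralOverIdeal {R D : Type*} [CommRing R] [CommRing D] [IsDomain D]
    (ψ : R →+* D) {π : D} (hπ : Prime π) (s : ℕ) {I : Ideal R} (hI : ∀ a ∈ I, π ^ s ∣ ψ a)
    {a : R} (ha : IsIntegralOverIdeal I a) : π ^ s ∣ ψ a := by
  by_contra hs
  have hfin : FiniteMultiplicity π (ψ a) := ⟨s, fun h => hs ((pow_dvd_pow π s.le_succ).trans h)⟩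
  obtain ⟨u, hu, hπu⟩ := hfin.exists_eq_pow_mul_and_not_dvd
  have hm : multiplicity π (ψ a) < s := by
    by_contra h
    exact hs (hu ▸ (pow_dvd_pow π (not_lt.1 h)).mul_right u)
  generalize multiplicity π (ψ a) = m at hu hm
  obtain ⟨k, hk, c, hc, h⟩ := ha
  have hpow : ∀ i, ∀ b ∈ I ^ i, π ^ (s * i) ∣ ψ b := by
    intro i b hb
    have h1 : I.map ψ ≤ Ideal.span {π ^ s} :=
      Ideal.map_le_iff_le_comap.2 fun a ha => Ideal.mem_span_singleton.2 (hI a ha)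
    have h2 : ψ b ∈ Ideal.span {π ^ s} ^ i :=
      Ideal.pow_right_mono h1 i (Ideal.map_pow ψ I i ▸ Ideal.mem_map_of_mem ψ hb)
    rwa [Ideal.span_singleton_pow, Ideal.mem_span_singleton, ← pow_mul] at h2
  have hsum : π ^ (m * k + 1) ∣ ψ (∑ i ∈ Finset.Icc 1 k, c i * a ^ (k - i)) := by
    rw [map_sum]
    refine Finset.dvd_sum fun i hi => ?_
    obtain ⟨hi1, hik⟩ := Finset.mem_Icc.1 hi
    rw [map_mul, map_pow, hu, mul_pow, ← pow_mul, ← mul_assoc]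
    refine Dvd.dvd.mul_right ?_ _
    refine (pow_dvd_pow π ?_).trans
      ((pow_add π (s * i) (m * (k - i))).dvd.trans (mul_dvd_mul_right (hpow i _ (hc i hi)) _))
    obtain ⟨j, rfl⟩ := Nat.exists_eq_add_of_le hik
    -- The exponent is at least `(m + 1) * i + m * (k - i) = m * k + i`.
    have h3 : (m + 1) * i ≤ s * i := Nat.mul_le_mul_right i hm
    rw [Nat.add_sub_cancel_left]
    nlinarith
  have hk' : π ^ (m * k + 1) ∣ π ^ (m * k) * u ^ k := by
    have h4 := congrArg ψ h
    rw [map_add, map_zero, map_pow, hu, mul_pow, ← pow_mul] at h4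
    rw [eq_neg_of_add_eq_zero_left h4]
    exact (dvd_neg).2 hsum
  rw [pow_succ, mul_dvd_mul_iff_left (pow_ne_zero _ hπ.ne_zero)] at hk'
  exact hπu (hπ.dvd_of_dvd_pow hk')

theorem idealIntegralClosure_le_of_isPrime {R : Type*} [CommRing R] {I P : Ideal R}
    [hP : P.IsPrime] (h : I ≤ P) : idealIntegralClosure I ≤ P := by
  rintro a ⟨k, hk, c, hc, ha⟩
  refine hP.mem_of_pow_mem k ?_
  rw [eq_neg_of_add_eq_zero_left ha]
  refine P.neg_mem (P.sum_mem fun i hi => P.mul_mem_right _ ?_)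
  exact h (Ideal.pow_le_self (by have := (Finset.mem_Icc.1 hi).1; omega) (hc i hi))

theorem mem_idealIntegralClosure_of_pow_mem {R : Type*} [CommRing R] {I : Ideal R} {a : R} {k : ℕ}
    (hk : 1 ≤ k) (h : a ^ k ∈ I ^ k) : a ∈ idealIntegralClosure I := by
  refine ⟨k, hk, fun i => if i = k then -a ^ k else 0, fun i _ => ?_, ?_⟩
  · dsimp only
    split_ifs with hik
    · exact hik ▸ (I ^ k).neg_mem h
    · exact zero_mem _
  · rw [Finset.sum_eq_single_of_mem k (Finset.mem_Icc.2 ⟨hk, le_rfl⟩)]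
    · simp
    · intro i _ hik
      simp [hik]

/-- The `K`-algebra endomorphism of the polynomial ring that sends the variables in `T` to zero and
fixes the other ones. -/
noncomputable def killVars {σ : Type*} [DecidableEq σ] (K : Type*) [Field K] (T : Finset σ) :
    MvPolynomial σ K →ₐ[K] MvPolynomial σ K :=
  aeval fun i => if i ∈ T then 0 else X i

theorem ker_killVars {σ K : Type*} [DecidableEq σ] [Field K] (T : Finset σ) :
    RingHom.ker (killVars K T) = Ideal.span (X '' (T : Set σ)) := by
  apply le_antisymm
  · intro f hf
    let J : Ideal (MvPolynomial σ K) := Ideal.span (X '' (T : Set σ))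
    have hcomp : (Ideal.Quotient.mkₐ K J).comp (killVars K T) = Ideal.Quotient.mkₐ K J := by
      refine algHom_ext fun i => ?_
      by_cases hi : i ∈ T
      · simp only [killVars, AlgHom.comp_apply, aeval_X, if_pos hi, map_zero]
        exact (Ideal.Quotient.eq_zero_iff_mem.2 (Ideal.subset_span (Set.mem_image_of_mem X hi))).symm
      · simp [killVars, hi]
    have h := DFunLike.congr_fun hcomp f
    rw [AlgHom.comp_apply, (RingHom.mem_ker).1 hf, map_zero] at h
    exact Ideal.Quotient.eq_zero_iff_mem.1 h.symm
  · rw [Ideal.span_le]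
    rintro _ ⟨i, hi, rfl⟩
    simp [killVars, RingHom.mem_ker, Finset.mem_coe.1 hi]

theorem X_mem_ker_killVars {σ K : Type*} [DecidableEq σ] [Field K] (T : Finset σ) (i : σ) :
    (X i : MvPolynomial σ K) ∈ RingHom.ker (killVars K T) ↔ i ∈ T := by
  by_cases hi : i ∈ T <;> simp [killVars, RingHom.mem_ker, hi]

theorem idealM_le_ker_killVars (K : Type*) [Field K] {n t : ℕ} (ht : 1 ≤ t) {a b : Fin n}
    (hab : a ≠ b) : idealM K n t ≤ RingHom.ker (killVars K {a, b}) := by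
  rw [idealM, Ideal.span_le]
  rintro _ ⟨i, rfl⟩
  obtain ⟨j, hji, hj⟩ : ∃ j, j ≠ i ∧ j ∈ ({a, b} : Finset (Fin n)) := by
    by_cases h : a = i
    · exact ⟨b, h ▸ hab.symm, by simp⟩
    · exact ⟨a, h, by simp⟩
  refine Ideal.mem_of_dvd _ (Finset.dvd_prod_of_mem _ (Finset.mem_erase.2 ⟨hji, Finset.mem_univ j⟩)) ?_
  exact Ideal.pow_mem_of_mem _ ((X_mem_ker_killVars _ j).2 hj) _ ht

/-- The homomorphism of `K`-algebras that multiplies the variables in `T` by a new variable. The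
order of vanishing of the image at zero is the order of a polynomial along the linear subspace where
the variables in `T` vanish. -/
noncomputable def scaleVars {σ : Type*} [DecidableEq σ] (K : Type*) [Field K] (T : Finset σ) :
    MvPolynomial σ K →ₐ[K] Polynomial (MvPolynomial σ K) :=
  aeval fun i => Polynomial.C (X i) * Polynomial.X ^ (if i ∈ T then 1 else 0)

/-- A monomial is multiplied by the power of the new variable that is its degree in `T`. -/
theorem scaleVars_prod {σ K : Type*} [DecidableEq σ] [Field K] (T s : Finset σ) (v : σ → ℕ) :
    scaleVars K T (∏ i ∈ s, X i ^ v i) = Polynomial.C (∏ i ∈ s, X i ^ v i) *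
      Polynomial.X ^ (∑ i ∈ s, (if i ∈ T then 1 else 0) * v i) := by
  rw [map_prod, map_prod, ← Finset.prod_pow_eq_pow_sum, ← Finset.prod_mul_distrib]
  refine Finset.prod_congr rfl fun i _ => ?_
  rw [map_pow, scaleVars, aeval_X, mul_pow, ← pow_mul, Polynomial.C_pow]

theorem coeff_zero_scaleVars {σ K : Type*} [DecidableEq σ] [Field K] (T : Finset σ)
    (f : MvPolynomial σ K) : (scaleVars K T f).coeff 0 = killVars K T f := by
  have : ((Polynomial.aeval (R := MvPolynomial σ K) (0 : MvPolynomial σ K)).restrictScalars K).comp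
      (scaleVars K T) = killVars K T := by
    refine algHom_ext fun i => ?_
    by_cases hi : i ∈ T <;> simp [scaleVars, killVars, hi]
  rw [← this, AlgHom.comp_apply, AlgHom.restrictScalars_apply, Polynomial.coeff_zero_eq_aeval_zero]

theorem X_pow_dvd_scaleVars_of_mem_idealM {K : Type*} [Field K] {n t : ℕ} (T : Finset (Fin n))
    (f : MvPolynomial (Fin n) K) (hf : f ∈ idealM K n t) :
    Polynomial.X ^ ((T.card - 1) * t) ∣ scaleVars K T f := by
  suffices h : idealM K n t ≤ (Ideal.span {Polynomial.X ^ ((T.card - 1) * t)}).comap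
      (scaleVars K T) from Ideal.mem_span_singleton.1 (h hf)
  rw [idealM, Ideal.span_le]
  rintro _ ⟨i, rfl⟩
  refine Ideal.mem_span_singleton.2 ?_
  rw [scaleVars_prod T _ fun _ => t]
  refine Dvd.dvd.mul_left (pow_dvd_pow _ ?_) _
  rw [← Finset.sum_mul]
  refine Nat.mul_le_mul_right t ?_
  have h1 := Finset.add_sum_erase Finset.univ (fun j => if j ∈ T then 1 else 0) (Finset.mem_univ i)
  have h2 : ∑ j : Fin n, (if j ∈ T then 1 else 0) = T.card := by simp
  rw [h2] at h1
  have h3 : (if i ∈ T then 1 else 0) ≤ 1 := by split_ifs <;> simp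
  omega

/-- The monomial with exponent vector `v` is integral over `M_{n,t}` if the deficits `t - v i` are
bounded by numbers `δ i` that add up to `t`: its `t`-th power is divisible by the product of the
`δ i`-th powers of the generators. -/
theorem prod_X_pow_mem_idealIntegralClosure (K : Type*) [Field K] {n t : ℕ} (ht : 1 ≤ t)
    (v δ : Fin n → ℕ) (hδ : ∑ i, δ i = t) (hv : ∀ i, t ≤ v i + δ i) :
    ∏ i, (X i : MvPolynomial (Fin n) K) ^ v i ∈ idealIntegralClosure (idealM K n t) := by
  refine mem_idealIntegralClosure_of_pow_mem ht ?_
  have hmem : ∏ i, (∏ j ∈ Finset.univ.erase i, (X j : MvPolynomial (Fin n) K) ^ t) ^ δ i ∈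
      idealM K n t ^ t := by
    rw [← hδ, ← Finset.prod_pow_eq_pow_sum, hδ]
    exact Ideal.prod_mem_prod fun i _ => Ideal.pow_mem_pow (Ideal.subset_span (Set.mem_range_self i)) _
  refine Ideal.mem_of_dvd _ ?_ hmem
  have heq : ∏ i, (∏ j ∈ Finset.univ.erase i, (X j : MvPolynomial (Fin n) K) ^ t) ^ δ i =
      ∏ j, ∏ i ∈ Finset.univ.erase j, ((X j : MvPolynomial (Fin n) K) ^ t) ^ δ i := by
    simp_rw [← Finset.prod_pow]
    refine Finset.prod_comm' fun i j => ?_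
    simp [eq_comm]
  rw [heq, ← Finset.prod_pow]
  refine Finset.prod_dvd_prod_of_dvd _ _ fun j _ => ?_
  rw [Finset.prod_pow_eq_pow_sum, ← pow_mul, ← pow_mul, mul_comm (v j)]
  refine pow_dvd_pow _ (Nat.mul_le_mul_left t ?_)
  have h1 := Finset.add_sum_erase Finset.univ δ (Finset.mem_univ j)
  have h2 := hv j
  omega

/-- The prime generated by three variables `X a`, `X b`, `X c` is associated to the integral closure:
it is the annihilator of the monomial `w` with exponents `t - 1`, `t - 1`, `1` at `a`, `b`, `c` and
`t` elsewhere. It is not minimal, because `X a`, `X b` generate a smaller prime that contains the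
integral closure. -/
theorem hasEmbeddedPrimes_idealIntegralClosure_idealM (K : Type*) [Field K] {n t : ℕ} (hn : 3 ≤ n)
    (ht : 2 ≤ t) : HasEmbeddedPrimes (idealIntegralClosure (idealM K n t)) := by
  obtain ⟨a, b, c, hab, hac, hbc⟩ : ∃ a b c : Fin n, a ≠ b ∧ a ≠ c ∧ b ≠ c :=
    ⟨⟨0, by omega⟩, ⟨1, by omega⟩, ⟨2, by omega⟩, by simp, by simp, by simp⟩
  let T : Finset (Fin n) := {a, b, c}
  have hT : T.card = 3 := Finset.card_eq_three.2 ⟨a, b, c, hab, hac, hbc, rfl⟩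
  let v : Fin n → ℕ := fun j => if j = a ∨ j = b then t - 1 else if j = c then 1 else t
  let w : MvPolynomial (Fin n) K := ∏ j, X j ^ v j
  have hw : w ≠ 0 := Finset.prod_ne_zero_iff.2 fun i _ => pow_ne_zero _ (X_ne_zero i)
  have hPprime : (RingHom.ker (killVars K T)).IsPrime := RingHom.ker_isPrime _
  have hQprime : (RingHom.ker (killVars K {a, b})).IsPrime := RingHom.ker_isPrime _
  -- The degree of `w` in `X a`, `X b`, `X c` is one less than the order `2 * t` of the generators.
  have hvT : ∑ i, (if i ∈ T then 1 else 0) * v i = 2 * t - 1 := by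
    simp only [ite_mul, one_mul, zero_mul, Finset.sum_ite_mem, Finset.univ_inter, T]
    rw [Finset.sum_insert (by simp [hab, hac]), Finset.sum_insert (by simp [hbc]),
      Finset.sum_singleton]
    simp only [v, true_or, or_true, if_true, hac.symm, hbc.symm, or_self, if_false]
    omega
  -- Multiplication by one of the three variables lowers the sum of the deficits from `t + 1` to `t`.
  have hmem : ∀ l ∈ T, X l * w ∈ idealIntegralClosure (idealM K n t) := by
    intro l hl
    have hXw : X l * w = ∏ j, (X j : MvPolynomial (Fin n) K) ^ (v j + if j = l then 1 else 0) := by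
      simp_rw [pow_add, Finset.prod_mul_distrib, w]
      rw [mul_comm]
      congr 1
      simp [Finset.prod_ite_eq', pow_ite]
    rw [hXw]
    simp only [T, Finset.mem_insert, Finset.mem_singleton] at hl
    rcases hl with rfl | rfl | rfl
    · refine prod_X_pow_mem_idealIntegralClosure K (by omega) _
        (fun j => (if j = b then 1 else 0) + if j = c then t - 1 else 0) ?_ fun j => ?_
      · simp only [Finset.sum_add_distrib, Finset.sum_ite_eq', Finset.mem_univ, if_true]
        omega
      · simp only [v]
        split_ifs <;> simp_all <;> omega
    · refine prod_X_pow_mem_idealIntegralClosure K (by omega) _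
        (fun j => (if j = a then 1 else 0) + if j = c then t - 1 else 0) ?_ fun j => ?_
      · simp only [Finset.sum_add_distrib, Finset.sum_ite_eq', Finset.mem_univ, if_true]
        omega
      · simp only [v]
        split_ifs <;> simp_all <;> omega
    · refine prod_X_pow_mem_idealIntegralClosure K (by omega) _
        (fun j => ((if j = a then 1 else 0) + if j = b then 1 else 0) +
          if j = l then t - 2 else 0) ?_ fun j => ?_
      · simp only [Finset.sum_add_distrib, Finset.sum_ite_eq', Finset.mem_univ, if_true]
        omega
      · simp only [v]
        split_ifs <;> simp_all <;> omega
  have hcolon : ∀ f, f * w ∈ idealIntegralClosure (idealM K n t) ↔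
      f ∈ RingHom.ker (killVars K T) := by
    intro f
    constructor
    · intro h
      have hdvd := pow_dvd_of_isIntegralOverIdeal (scaleVars K T).toRingHom Polynomial.prime_X
        ((T.card - 1) * t) (X_pow_dvd_scaleVars_of_mem_idealM T) h
      -- If `f` does not vanish where the variables in `T` do, then the order of `f * w` along that
      -- subspace is the degree `2 * t - 1` of `w` in these variables, too small for an element of the
      -- integral closure.
      have hexp : (T.card - 1) * t = (2 * t - 1) + 1 := by rw [hT]; omega
      change _ ∣ scaleVars K T (f * w) at hdvd
      rw [map_mul, scaleVars_prod, hvT, ← mul_assoc, hexp, pow_succ',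
        mul_dvd_mul_iff_right (pow_ne_zero _ Polynomial.X_ne_zero), Polynomial.X_dvd_iff,
        Polynomial.mul_coeff_zero, coeff_zero_scaleVars, Polynomial.coeff_C_zero] at hdvd
      exact (RingHom.mem_ker).2 ((mul_eq_zero.1 hdvd).resolve_right hw)
    · intro hf
      have hle : RingHom.ker (killVars K T) ≤
          Submodule.comap (LinearMap.mulRight (MvPolynomial (Fin n) K) w)
            (idealIntegralClosure (idealM K n t)) := by
        rw [ker_killVars, Ideal.span_le]
        rintro _ ⟨l, hl, rfl⟩
        exact hmem l hl
      exact hle hf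
  refine ⟨RingHom.ker (killVars K T), ?_, fun hmin => ?_⟩
  · refine (isAssociatedPrime_iff).2 ⟨hPprime, Ideal.Quotient.mk _ w, ?_⟩
    ext f
    rw [Submodule.mem_colon_singleton, Submodule.mem_bot, ← hcolon f,
      ← Ideal.Quotient.eq_zero_iff_mem, map_mul]
    rfl
  · have hQP : RingHom.ker (killVars K {a, b}) ≤ RingHom.ker (killVars K T) := by
      rw [ker_killVars, ker_killVars]
      exact Ideal.span_mono (Set.image_mono (by
        intro j hj
        simp only [Finset.coe_insert, Finset.coe_singleton, Set.mem_insert_iff,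
          Set.mem_singleton_iff, T] at hj ⊢
        tauto))
    have hPQ := hmin.2 ⟨hQprime, idealIntegralClosure_le_of_isPrime
      (idealM_le_ker_killVars K (by omega) hab)⟩ hQP
    have hc := hPQ ((X_mem_ker_killVars T c).2 (by simp [T]))
    rw [X_mem_ker_killVars] at hc
    simp [hac.symm, hbc.symm] at hc

theorem corollary1p6 (K : Type*) [Field K] (n t : ℕ) (hn : 1 ≤ n) (ht : 1 ≤ t) :
    IsCohenMacaulay (MvPolynomial (Fin n) K ⧸ idealM K n t) ∧
      (3 ≤ n → 2 ≤ t → HasEmbeddedPrimes (idealIntegralClosure (idealM K n t))) :=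
  ⟨isCohenMacaulay_quotient_idealM K n t hn,
    fun hn3 ht2 => hasEmbeddedPrimes_idealIntegralClosure_idealM K hn3 ht2⟩
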